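/- Let $\mathcal U$ and $\mathcal Y$ be complex Hilbert spaces, let $\mathbb C^+=\{\mu\in\mathbb C:\operatorname{Re}\mu>0\}$, and let $\varphi$ be a holomorphic function on $\mathbb C^+$ whose values are contractions from $\mathcal U$ to $\mathcal Y$. Put $\widetilde\varphi(\mu):=\varphi(\overline\mu)^*$, and let $\mathcal H_c$ be the Hilbert space of $\mathcal U$-valued functions on $\mathbb C^+$ with reproducing kernel $$K_c(\mu,\lambda)=\frac{1-\varphi(\overline\mu)^*\varphi(\overline\lambda)}{\mu+\overline\lambda},\qquad \mu,\lambda\in\mathbb C^+ .$$ Let $e_c(\lambda)$ denote evaluation at $\lambda$ on $\mathcal H_c$, so that $e_c(\lambda)^*u=K_c(\cdot,\lambda)u$. The controllable model $S_c=\left[\begin{smallmatrix}A\&B\\C\&D\end{smallmatrix}\right]_c:\mathcal H_c\oplus\mathcal U\supset\operatorname{dom}S_c\to\mathcal H_c\oplus\mathcal Y$ is the closure of the linear operator on the span of the vectors $\left[\begin{smallmatrix}e_c(\overline\lambda)^*u\\u\end{smallmatrix}\right]$ that is determined by $$\begin{bmatrix}e_c(\overline\lambda)^*u\\u\end{bmatrix}\mapsto\begin{bmatrix}\lambda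 e_c(\overline\lambda)^*u\\\varphi(\lambda)u\end{bmatrix},\qquad \lambda\in\mathbb C^+,\ u\in\mathcal U .$$ (This operator is well defined, closable and densely defined.) **Theorem.** The Hilbert space adjoint $S_c^*$ (the dual system node of $S_c$), an operator from $\mathcal H_c\oplus\mathcal Y$ to $\mathcal H_c\oplus\mathcal U$, has the domain $$\operatorname{dom}S_c^*=\left\{\begin{bmatrix}x\\y\end{bmatrix}\in\mathcal H_c\oplus\mathcal Y \;\middle|\; \exists\,u\in\mathcal U:\ \text{the function } \mu\mapsto\mu x(\mu)+\widetilde\varphi(\mu)y-u \text{ lies in } \mathcal H_c\right\}.$$ For every $\left[\begin{smallmatrix}x\\y\end{smallmatrix}\right]\in\operatorname{dom}S_c^*$ one has $S_c^*\left[\begin{smallmatrix}x\\y\end{smallmatrix}\right]=\left[\begin{smallmatrix}z\\u\end{smallmatrix}\right]$, where $$z(\mu)=\mu x(\mu)+\widetilde\varphi(\mu)y-u\quad(\mu\in\mathbb C^+),\qquad u=\lim_{\operatorname{Re}\eta\to\infty}\bigl(\eta x(\eta)+\widetilde\varphi(\eta)y\bigr),$$ the limit existing in the norm of $\mathcal U$.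 Moreover, this $u$ is the only vector in $\mathcal U$ for which $\mu\mapsto\mu x(\mu)+\widetilde\varphi(\mu)y-u$ lies in $\mathcal H_c$. -/

import Mathlib

open scoped ComplexConjugate InnerProductSpace
open Filter Topology

namespace HalfPlane

/-- The open right half-plane. -/
abbrev Cplus : Type := {μ : ℂ // 0 < μ.re}

/-- Complex conjugation on the right half-plane. -/
def Cplus.conj (μ : Cplus) : Cplus := ⟨starRingEnd ℂ μ.1, by simpa using μ.2⟩

section KernelPositivity
variable {U Y : Type*} [NormedAddCommGroup U] [InnerProductSpace ℂ U] [CompleteSpace U]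
  [NormedAddCommGroup Y] [InnerProductSpace ℂ Y] [CompleteSpace Y]

theorem differentiableAt_adjoint_conj {φ : ℂ → U →L[ℂ] Y} {μ : ℂ}
    (h : DifferentiableAt ℂ φ (conj μ)) :
    DifferentiableAt ℂ (fun ζ => ContinuousLinearMap.adjoint (φ (conj ζ))) μ := by
  have h' : HasFDerivAt φ (fderiv ℂ φ (conj μ)) ((starL ℂ : ℂ ≃L⋆[ℂ] ℂ).toContinuousLinearMap μ) :=
    h.hasFDerivAt
  exact (h'.comp_semilinear
    (ContinuousLinearMap.adjoint (𝕜 := ℂ) (E := U) (F := Y)).toContinuousLinearEquiv.toContinuousLinearMap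
    (starL ℂ : ℂ ≃L⋆[ℂ] ℂ).toContinuousLinearMap).differentiableAt

/-- The Szegő kernel of the disc with centre `c` and radius `R`, up to a constant factor. -/
noncomputable def discKernel (c R : ℝ) (ζ w : ℂ) : ℂ := ((R : ℂ) ^ 2 - (ζ - c) * (conj w - c))⁻¹

theorem discKernel_ne {c R : ℝ} (hR : 0 < R) {ζ w : ℂ} (hζ : ζ ∈ Metric.closedBall (c : ℂ) R)
    (hw : w ∈ Metric.ball (c : ℂ) R) : (R : ℂ) ^ 2 - (ζ - c) * (conj w - c) ≠ 0 := by
  intro h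
  have h1 : ‖(ζ - c) * (conj w - c)‖ = R ^ 2 := by
    rw [← sub_eq_zero.1 h]; simp [abs_of_pos hR]
  rw [mem_closedBall_iff_norm] at hζ
  rw [mem_ball_iff_norm] at hw
  have h2 : ‖conj w - (c : ℂ)‖ = ‖w - c‖ := by
    rw [← Complex.norm_conj (w - c)]; simp
  rw [norm_mul, h2] at h1
  nlinarith [norm_nonneg (ζ - c), norm_nonneg (w - c)]

theorem differentiableOn_discKernel {c R : ℝ} (hR : 0 < R) {w : ℂ}
    (hw : w ∈ Metric.ball (c : ℂ) R) :
    DifferentiableOn ℂ (fun ζ => discKernel c R ζ w) (Metric.closedBall (c : ℂ) R) := by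
  unfold discKernel
  refine DifferentiableOn.fun_inv (by fun_prop) fun ζ hζ => discKernel_ne hR hζ hw

theorem circleAverage_inner_discKernel {c R : ℝ} (hR : 0 < R) (s : Finset Cplus) (a : Cplus → U)
    (hs : ∀ i ∈ s, (i : ℂ) ∈ Metric.ball (c : ℂ) R) {G : ℂ → U}
    (hG : DiffContOnCl ℂ G (Metric.ball (c : ℂ) R)) :
    Real.circleAverage (fun ζ => ⟪∑ i ∈ s, discKernel c R ζ i • a i, G ζ⟫_ℂ) c R
      = ((R : ℂ) ^ 2)⁻¹ * ∑ i ∈ s, ⟪a i, G i⟫_ℂ := by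
  have hR0 : (R : ℂ) ≠ 0 := by exact_mod_cast hR.ne'
  have key : ∀ i ∈ s, DiffContOnCl ℂ (fun ζ => ((R : ℂ) ^ 2)⁻¹ * ⟪a i, G ζ⟫_ℂ)
      (Metric.ball (c : ℂ) |R|) := by
    intro i _
    rw [abs_of_pos hR]
    exact ((innerSL ℂ (a i)).differentiable.comp_diffContOnCl hG).const_smul (((R : ℂ) ^ 2)⁻¹)
  have h1 : Real.circleAverage (fun ζ => ⟪∑ i ∈ s, discKernel c R ζ i • a i, G ζ⟫_ℂ) c R
      = Real.circleAverage (fun ζ => ∑ i ∈ s, ((ζ - c) / (ζ - i)) •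
          (((R : ℂ) ^ 2)⁻¹ * ⟪a i, G ζ⟫_ℂ)) c R := by
    apply Real.circleAverage_congr_sphere
    intro ζ hζ
    rw [abs_of_pos hR, mem_sphere_iff_norm] at hζ
    simp only [sum_inner, inner_smul_left]
    refine Finset.sum_congr rfl fun i hi => ?_
    have hi' := hs i hi
    rw [mem_ball_iff_norm] at hi'
    have hne : ζ - i ≠ 0 := by
      intro h
      rw [sub_eq_zero.1 h] at hζ
      linarith
    have hz : ζ - c ≠ 0 := by
      intro h
      rw [h] at hζ
      simp at hζ
      linarith
    have hsq : (ζ - c) * (conj ζ - c) = (R : ℂ) ^ 2 := by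
      have := Complex.mul_conj (ζ - c)
      rw [Complex.normSq_eq_norm_sq, hζ] at this
      simpa using this
    have hk : conj (discKernel c R ζ i) = ((R : ℂ) ^ 2)⁻¹ * ((ζ - c) / (ζ - i)) := by
      have hq : (R : ℂ) ^ 2 - (conj ζ - c) * (i - c) = (R : ℂ) ^ 2 * (ζ - i) / (ζ - c) := by
        rw [eq_div_iff hz]
        linear_combination (-((i : ℂ) - c)) * hsq
      simp only [discKernel, map_inv₀, map_sub, map_mul, map_pow, Complex.conj_ofReal,
        Complex.conj_conj]
      rw [hq]
      field_simp
    rw [hk, smul_eq_mul]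
    ring
  have hint : ∀ i ∈ s, CircleIntegrable (fun ζ => ((ζ - c) / (ζ - i)) •
          (((R : ℂ) ^ 2)⁻¹ * ⟪a i, G ζ⟫_ℂ)) c R := by
    intro i hi
    apply ContinuousOn.circleIntegrable hR.le
    have hi' := hs i hi
    rw [mem_ball_iff_norm] at hi'
    refine ContinuousOn.smul (f := fun ζ : ℂ => (ζ - c) / (ζ - i))
      (ContinuousOn.div (by fun_prop) (by fun_prop) ?_) ?_
    · intro ζ hζ h
      rw [mem_sphere_iff_norm, sub_eq_zero.1 h] at hζ
      linarith
    · have := (key i hi).continuousOn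
      rw [abs_of_pos hR, closure_ball _ hR.ne'] at this
      exact this.mono Metric.sphere_subset_closedBall
  rw [h1, Real.circleAverage_fun_sum hint, Finset.mul_sum]
  refine Finset.sum_congr rfl fun i hi => ?_
  exact (key i hi).circleAverage_smul_div (by rw [abs_of_pos hR]; exact hs i hi)

theorem disc_kernel_nonneg {φ : ℂ → U →L[ℂ] Y}
    (hd : DifferentiableOn ℂ φ {μ | 0 < μ.re}) (hc : ∀ μ : ℂ, 0 < μ.re → ‖φ μ‖ ≤ 1)
    {c R : ℝ} (hR : 0 < R) (hcR : R < c) (s : Finset Cplus) (u : Cplus → U)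
    (hs : ∀ i ∈ s, (i : ℂ) ∈ Metric.ball (c : ℂ) R) :
    0 ≤ (∑ i ∈ s, ∑ j ∈ s, discKernel c R i j *
      (⟪u i, u j⟫_ℂ - ⟪φ (conj (i : ℂ)) (u i), φ (conj (j : ℂ)) (u j)⟫_ℂ)).re := by
  have hpos : ∀ ζ ∈ Metric.closedBall (c : ℂ) R, 0 < ζ.re := by
    intro ζ hζ
    rw [mem_closedBall_iff_norm] at hζ
    have h1 := (abs_le.1 (Complex.abs_re_le_norm (ζ - c))).1
    simp at h1
    linarith
  set f : ℂ → U := fun ζ => ∑ j ∈ s, discKernel c R ζ j • u j with hf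
  set g : ℂ → Y := fun ζ => ∑ j ∈ s, discKernel c R ζ j • φ (conj (j : ℂ)) (u j) with hg
  set F : ℂ → U := fun ζ => ContinuousLinearMap.adjoint (φ (conj ζ)) (g ζ) with hF
  have hfd : DifferentiableOn ℂ f (Metric.closedBall (c : ℂ) R) :=
    DifferentiableOn.fun_sum fun j hj => (differentiableOn_discKernel hR (hs j hj)).smul_const _
  have hgd : DifferentiableOn ℂ g (Metric.closedBall (c : ℂ) R) :=
    DifferentiableOn.fun_sum fun j hj => (differentiableOn_discKernel hR (hs j hj)).smul_const _
  have hopen : IsOpen {μ : ℂ | 0 < μ.re} := isOpen_lt continuous_const Complex.continuous_re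
  have had : DifferentiableOn ℂ (fun ζ => ContinuousLinearMap.adjoint (φ (conj ζ)))
      (Metric.closedBall (c : ℂ) R) := by
    intro ζ hζ
    refine (differentiableAt_adjoint_conj ?_).differentiableWithinAt
    refine hd.differentiableAt (hopen.mem_nhds ?_)
    simpa using hpos ζ hζ
  have hFd : DifferentiableOn ℂ F (Metric.closedBall (c : ℂ) R) := had.clm_apply hgd
  have hcl : closure (Metric.ball (c : ℂ) R) = Metric.closedBall (c : ℂ) R :=
    closure_ball _ hR.ne'
  have A1 := circleAverage_inner_discKernel hR s u hs
    (DifferentiableOn.diffContOnCl (by rwa [hcl]) : DiffContOnCl ℂ f (Metric.ball (c : ℂ) R))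
  have A2 := circleAverage_inner_discKernel hR s (fun j => φ (conj (j : ℂ)) (u j)) hs
    (DifferentiableOn.diffContOnCl (by rwa [hcl]) : DiffContOnCl ℂ g (Metric.ball (c : ℂ) R))
  have A3 := circleAverage_inner_discKernel hR s u hs
    (DifferentiableOn.diffContOnCl (by rwa [hcl]) : DiffContOnCl ℂ F (Metric.ball (c : ℂ) R))
  change Real.circleAverage (fun ζ => ⟪f ζ, f ζ⟫_ℂ) c R = _ at A1
  change Real.circleAverage (fun ζ => ⟪g ζ, g ζ⟫_ℂ) c R = _ at A2
  change Real.circleAverage (fun ζ => ⟪f ζ, F ζ⟫_ℂ) c R = _ at A3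
  have h23 : Real.circleAverage (fun ζ => ⟪f ζ, F ζ⟫_ℂ) c R
      = Real.circleAverage (fun ζ => ⟪g ζ, g ζ⟫_ℂ) c R := by
    rw [A2, A3]
    congr 1
    refine Finset.sum_congr rfl fun i _ => ?_
    simp only [hF, ContinuousLinearMap.adjoint_inner_right]
  have cont : ∀ {W : Type _} [NormedAddCommGroup W] [InnerProductSpace ℂ W] {p q : ℂ → W},
      DifferentiableOn ℂ p (Metric.closedBall (c : ℂ) R) →
      DifferentiableOn ℂ q (Metric.closedBall (c : ℂ) R) →
      CircleIntegrable (fun ζ => ⟪p ζ, q ζ⟫_ℂ) c R := by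
    intro W _ _ p q hp hq
    apply ContinuousOn.circleIntegrable hR.le
    exact (hp.continuousOn.inner hq.continuousOn).mono Metric.sphere_subset_closedBall
  have Iff := cont hfd hfd
  have Igg : CircleIntegrable (fun ζ => ⟪g ζ, g ζ⟫_ℂ) c R :=
    ContinuousOn.circleIntegrable hR.le ((hgd.continuousOn.inner hgd.continuousOn).mono
      Metric.sphere_subset_closedBall)
  have IfF := cont hfd hFd
  have avgre : ∀ {h : ℂ → ℂ}, CircleIntegrable h c R →
      Real.circleAverage (fun ζ => (h ζ).re) c R = (Real.circleAverage h c R).re :=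
    fun hh => Complex.reCLM.circleAverage_comp_comm hh
  have rei : ∀ {h : ℂ → ℂ}, CircleIntegrable h c R → CircleIntegrable (fun ζ => (h ζ).re) c R := by
    intro h hh
    exact ⟨hh.1.re, hh.2.re⟩
  have mono : Real.circleAverage (fun ζ => (2 : ℝ) • (⟪f ζ, F ζ⟫_ℂ).re) c R
      ≤ Real.circleAverage (fun ζ => (⟪f ζ, f ζ⟫_ℂ).re + (⟪g ζ, g ζ⟫_ℂ).re) c R := by
    refine Real.circleAverage_mono ((rei IfF).const_smul (a := (2 : ℝ)))
      ((rei Iff).add (rei Igg)) fun ζ hζ => ?_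
    rw [abs_of_pos hR] at hζ
    have hζ' := hpos ζ (Metric.sphere_subset_closedBall hζ)
    have e1 : (⟪f ζ, f ζ⟫_ℂ).re = ‖f ζ‖ ^ 2 := inner_self_eq_norm_sq (𝕜 := ℂ) (f ζ)
    have e2 : (⟪g ζ, g ζ⟫_ℂ).re = ‖g ζ‖ ^ 2 := inner_self_eq_norm_sq (𝕜 := ℂ) (g ζ)
    have e3 : (⟪f ζ, F ζ⟫_ℂ).re ≤ ‖f ζ‖ * ‖F ζ‖ := re_inner_le_norm (𝕜 := ℂ) (f ζ) (F ζ)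
    have e4 : ‖F ζ‖ ≤ ‖g ζ‖ := by
      refine (ContinuousLinearMap.le_opNorm _ _).trans ?_
      have : ‖ContinuousLinearMap.adjoint (φ (conj ζ))‖ ≤ 1 := by
        rw [LinearIsometryEquiv.norm_map]
        exact hc _ (by simpa using hζ')
      nlinarith [norm_nonneg (g ζ)]
    simp only [smul_eq_mul]
    rw [e1, e2]
    nlinarith [norm_nonneg (f ζ), norm_nonneg (F ζ), norm_nonneg (g ζ), sq_nonneg (‖f ζ‖ - ‖g ζ‖)]
  rw [Real.circleAverage_fun_smul, Real.circleAverage_fun_add (rei Iff) (rei Igg), avgre Iff, avgre Igg,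
    avgre IfF, h23, A1, A2, smul_eq_mul] at mono
  have hR2 : ((R : ℂ) ^ 2)⁻¹ = (((R ^ 2)⁻¹ : ℝ) : ℂ) := by push_cast; rfl
  rw [hR2, Complex.re_ofReal_mul, Complex.re_ofReal_mul] at mono
  have hR3 : 0 < (R ^ 2)⁻¹ := by positivity
  have hfin : (∑ i ∈ s, ⟪φ (conj (i : ℂ)) (u i), g i⟫_ℂ).re ≤ (∑ i ∈ s, ⟪u i, f i⟫_ℂ).re := by
    nlinarith
  have : (∑ i ∈ s, ∑ j ∈ s, discKernel c R i j *
      (⟪u i, u j⟫_ℂ - ⟪φ (conj (i : ℂ)) (u i), φ (conj (j : ℂ)) (u j)⟫_ℂ))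
      = (∑ i ∈ s, ⟪u i, f i⟫_ℂ) - ∑ i ∈ s, ⟪φ (conj (i : ℂ)) (u i), g i⟫_ℂ := by
    simp only [hf, hg, inner_sum, inner_smul_right, mul_sub, Finset.sum_sub_distrib]
  rw [this, Complex.sub_re]
  linarith

theorem halfPlane_kernel_nonneg {φ : ℂ → U →L[ℂ] Y}
    (hd : DifferentiableOn ℂ φ {μ | 0 < μ.re}) (hc : ∀ μ : ℂ, 0 < μ.re → ‖φ μ‖ ≤ 1)
    (s : Finset Cplus) (u : Cplus → U) :
    0 ≤ (∑ i ∈ s, ∑ j ∈ s, ((i : ℂ) + conj (j : ℂ))⁻¹ *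
      (⟪u i, u j⟫_ℂ - ⟪φ (conj (i : ℂ)) (u i), φ (conj (j : ℂ)) (u j)⟫_ℂ)).re := by
  -- the discs of centre `c` and radius `√(c² - 1)` exhaust the half-plane as `c → ∞`
  have hlim : ∀ i j : Cplus, Tendsto (fun c : ℝ => (c : ℂ) * discKernel c √(c ^ 2 - 1) i j) atTop
      (𝓝 (((i : ℂ) + conj (j : ℂ))⁻¹)) := by
    intro i j
    have hij : (i : ℂ) + conj (j : ℂ) ≠ 0 := by
      intro h
      have := congrArg Complex.re h
      have hi := i.2
      have hj := j.2
      simp at this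
      linarith
    have h1 : Tendsto (fun c : ℝ => ((i : ℂ) + conj (j : ℂ)) - ((c⁻¹ : ℝ) : ℂ) * (i * conj (j : ℂ) + 1))
        atTop (𝓝 ((i : ℂ) + conj (j : ℂ) - ((0 : ℝ) : ℂ) * (i * conj (j : ℂ) + 1))) :=
      tendsto_const_nhds.sub
        (((Complex.continuous_ofReal.tendsto 0).comp tendsto_inv_atTop_zero).mul tendsto_const_nhds)
    simp only [Complex.ofReal_zero, zero_mul, sub_zero] at h1
    refine (h1.inv₀ hij).congr' ?_
    filter_upwards [eventually_gt_atTop 1] with c hc1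
    have hc0 : (c : ℂ) ≠ 0 := by exact_mod_cast (by linarith : c ≠ 0)
    have hsq : ((√(c ^ 2 - 1) : ℝ) : ℂ) ^ 2 = (c : ℂ) ^ 2 - 1 := by
      rw [← Complex.ofReal_pow, Real.sq_sqrt (by nlinarith)]
      push_cast; rfl
    rw [discKernel, hsq, ← inv_inv (c : ℂ), ← mul_inv]
    congr 1
    push_cast
    rw [inv_inv]
    field_simp
    ring
  have hball : ∀ i : Cplus, ∀ᶠ c : ℝ in atTop, (i : ℂ) ∈ Metric.ball (c : ℂ) √(c ^ 2 - 1) := by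
    intro i
    have hi := i.2
    filter_upwards [eventually_gt_atTop 1,
      eventually_gt_atTop ((Complex.normSq i + 1) / (2 * (i : ℂ).re))] with c h1 h2
    rw [div_lt_iff₀ (by positivity)] at h2
    rw [mem_ball_iff_norm]
    apply Real.lt_sqrt_of_sq_lt
    rw [← Complex.normSq_eq_norm_sq, Complex.normSq_apply]
    rw [Complex.normSq_apply] at h2
    simp
    nlinarith
  have hT : Tendsto (fun c : ℝ => (∑ i ∈ s, ∑ j ∈ s, ((c : ℂ) * discKernel c √(c ^ 2 - 1) i j) *
      (⟪u i, u j⟫_ℂ - ⟪φ (conj (i : ℂ)) (u i), φ (conj (j : ℂ)) (u j)⟫_ℂ)).re) atTop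
      (𝓝 (∑ i ∈ s, ∑ j ∈ s, ((i : ℂ) + conj (j : ℂ))⁻¹ *
      (⟪u i, u j⟫_ℂ - ⟪φ (conj (i : ℂ)) (u i), φ (conj (j : ℂ)) (u j)⟫_ℂ)).re) :=
    (Complex.continuous_re.tendsto _).comp (tendsto_finsetSum _ fun i _ => tendsto_finsetSum _
      fun j _ => (hlim i j).mul_const _)
  refine ge_of_tendsto hT ?_
  filter_upwards [(Finset.eventually_all s).2 fun i _ => hball i, eventually_gt_atTop 1] with c hcs hc1
  have hpos : 0 < c ^ 2 - 1 := by nlinarith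
  have := disc_kernel_nonneg hd hc (Real.sqrt_pos.2 hpos)
    ((Real.sqrt_lt' (by linarith)).2 (by linarith) : √(c ^ 2 - 1) < c) s u hcs
  simp only [mul_assoc, ← Finset.mul_sum]
  rw [Complex.re_ofReal_mul]
  exact mul_nonneg (by linarith) this

end KernelPositivity

/-- The Schur class of the right half-plane: functions that are holomorphic on the open right
half-plane and whose values there are contractions from `U` to `Y`. The values of `toFun` outside
the half-plane play no role. -/
structure SchurFunction (U Y : Type*) [NormedAddCommGroup U] [InnerProductSpace ℂ U]
    [NormedAddCommGroup Y] [InnerProductSpace ℂ Y] where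
  toFun : ℂ → U →L[ℂ] Y
  holomorphic : DifferentiableOn ℂ toFun {μ | 0 < μ.re}
  contractive : ∀ μ : ℂ, 0 < μ.re → ‖toFun μ‖ ≤ 1

section Model

variable {U Y : Type*} [NormedAddCommGroup U] [InnerProductSpace ℂ U] [CompleteSpace U]
  [NormedAddCommGroup Y] [InnerProductSpace ℂ Y] [CompleteSpace Y]

/-- `φ̃(μ) = φ(μ̄)*`. -/
noncomputable def SchurFunction.tilde (φ : SchurFunction U Y) (μ : Cplus) : Y →L[ℂ] U :=
  ContinuousLinearMap.adjoint (φ.toFun μ.conj)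

/-- The kernel `K_c(μ, lam) = (1 - φ(μ̄)* φ(lam̄)) / (μ + lam̄)`. -/
noncomputable def Kc (φ : SchurFunction U Y) : Matrix Cplus Cplus (U →L[ℂ] U) :=
  Matrix.of fun μ lam =>
    ((μ : ℂ) + conj (lam : ℂ))⁻¹ •
      (ContinuousLinearMap.id ℂ U - φ.tilde μ ∘L φ.toFun lam.conj)

theorem inner_Kc (φ : SchurFunction U Y) (μ lam : Cplus) (u v : U) :
    ⟪v, Kc φ μ lam u⟫_ℂ = ((μ : ℂ) + conj (lam : ℂ))⁻¹ *
      (⟪v, u⟫_ℂ - ⟪φ.toFun (conj (μ : ℂ)) v, φ.toFun (conj (lam : ℂ)) u⟫_ℂ) := by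
  simp [Kc, SchurFunction.tilde, Cplus.conj,
    ContinuousLinearMap.adjoint_inner_right]

instance Kc_posSemidef (φ : SchurFunction U Y) : Fact (Kc φ).PosSemidef := by
  have tfae := (RKHS.posSemidef_tfae (K := Kc φ)).out 0 2
  refine ⟨tfae.2 ⟨?_, fun vv => ?_⟩⟩
  · ext μ lam u
    refine ext_inner_left ℂ fun v => ?_
    rw [Matrix.conjTranspose_apply, ContinuousLinearMap.star_eq_adjoint,
      ContinuousLinearMap.adjoint_inner_right, ← inner_conj_symm, inner_Kc, inner_Kc]
    simp [add_comm]
  · have h := halfPlane_kernel_nonneg φ.holomorphic φ.contractive vv.support vv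
    have e : vv.sum (fun x w => vv.sum fun x' w' => ⟪Kc φ x' x w, w'⟫_ℂ)
        = conj (∑ i ∈ vv.support, ∑ j ∈ vv.support, ((i : ℂ) + conj (j : ℂ))⁻¹ *
      (⟪vv i, vv j⟫_ℂ - ⟪φ.toFun (conj (i : ℂ)) (vv i), φ.toFun (conj (j : ℂ)) (vv j)⟫_ℂ)) := by
      rw [map_sum, Finsupp.sum]
      simp only [map_sum, Finsupp.sum]
      rw [Finset.sum_comm]
      refine Finset.sum_congr rfl fun i _ => Finset.sum_congr rfl fun j _ => ?_
      rw [← inner_conj_symm, inner_Kc]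
    rw [e]
    exact (RCLike.conj_re (K := ℂ) _).symm ▸ h

/-- The de Branges-Rovnyak space `H_c`: the Hilbert space of `U`-valued functions on the right
half-plane with reproducing kernel `K_c` (that `RKHS.kernel (Hc φ) = Kc φ` is
`RKHS.OfKernel.kernel_ofKernel`). A function belongs to the space if it is the coercion of an
element. -/
abbrev Hc (φ : SchurFunction U Y) := RKHS.OfKernel (Kc φ)

/-- The linear span of the pairs
`([e_c(lam̄)* u ; u], [lam e_c(lam̄)* u ; φ(lam) u])`, `lam` in the right half-plane, `u ∈ U`,
where `e_c(·)* = RKHS.kerFun` is the adjoint of point evaluation in `H_c`. -/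
noncomputable def preGraph (φ : SchurFunction U Y) :
    Submodule ℂ (WithLp 2 (Hc φ × U) × WithLp 2 (Hc φ × Y)) :=
  Submodule.span ℂ {p | ∃ (lam : Cplus) (u : U),
    p = (WithLp.toLp 2 (RKHS.kerFun (Hc φ) lam.conj u, u),
      WithLp.toLp 2 ((lam : ℂ) • RKHS.kerFun (Hc φ) lam.conj u, φ.toFun lam u))}

/-- The operator on `span {[e_c(lam̄)* u ; u]}` with graph `preGraph φ` (see `preModel_graph`). -/
noncomputable def preModel (φ : SchurFunction U Y) :
    WithLp 2 (Hc φ × U) →ₗ.[ℂ] WithLp 2 (Hc φ × Y) :=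
  (preGraph φ).toLinearPMap

/-- The controllable functional model of `φ`: the closure of `preModel φ`. Its graph is
the closure of the span `preGraph φ` (`model_graph`) and its domain is dense (`model_dense`), so
that `(model φ).adjoint` is the genuine Hilbert space adjoint. -/
noncomputable def model (φ : SchurFunction U Y) :
    WithLp 2 (Hc φ × U) →ₗ.[ℂ] WithLp 2 (Hc φ × Y) :=
  (preModel φ).closure

theorem kerFun_inner_kerFun (φ : SchurFunction U Y) (μ lam : Cplus) (u v : U) :
    ⟪RKHS.kerFun (Hc φ) μ.conj v, RKHS.kerFun (Hc φ) lam.conj u⟫_ℂ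
      = (conj (μ : ℂ) + lam)⁻¹ * (⟪v, u⟫_ℂ - ⟪φ.toFun μ v, φ.toFun lam u⟫_ℂ) := by
  rw [RKHS.kerFun_inner, RKHS.kerFun_apply, RKHS.OfKernel.kernel_ofKernel, inner_Kc]
  simp [Cplus.conj]

/-- The power-balance form of a pair of graph elements. -/
noncomputable def balance {H : Type*} [NormedAddCommGroup H] [InnerProductSpace ℂ H]
    (p q : WithLp 2 (H × U) × WithLp 2 (H × Y)) : ℂ :=
  ⟪p.2.fst, q.1.fst⟫_ℂ + ⟪p.1.fst, q.2.fst⟫_ℂ - ⟪p.1.snd, q.1.snd⟫_ℂ + ⟪p.2.snd, q.2.snd⟫_ℂ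

theorem balance_eq_zero_of_mem_closure {H : Type*} [NormedAddCommGroup H] [InnerProductSpace ℂ H]
    {s : Set (WithLp 2 (H × U) × WithLp 2 (H × Y))} (hs : ∀ p ∈ s, ∀ q ∈ s, balance p q = 0)
    {p q : WithLp 2 (H × U) × WithLp 2 (H × Y)} (hp : p ∈ closure s) (hq : q ∈ closure s) :
    balance p q = 0 := by
  have c1 : Continuous fun r : WithLp 2 (H × U) => r.fst :=
    continuous_fst.comp (WithLp.prod_continuous_ofLp 2 H U)
  have c2 : Continuous fun r : WithLp 2 (H × U) => r.snd :=
    continuous_snd.comp (WithLp.prod_continuous_ofLp 2 H U)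
  have c3 : Continuous fun r : WithLp 2 (H × Y) => r.fst :=
    continuous_fst.comp (WithLp.prod_continuous_ofLp 2 H Y)
  have c4 : Continuous fun r : WithLp 2 (H × Y) => r.snd :=
    continuous_snd.comp (WithLp.prod_continuous_ofLp 2 H Y)
  have hc : ∀ a : WithLp 2 (H × U) × WithLp 2 (H × Y), Continuous fun b => balance a b := fun a =>
    (((continuous_const.inner (c1.comp continuous_fst)).add
      (continuous_const.inner (c3.comp continuous_snd))).sub
      (continuous_const.inner (c2.comp continuous_fst))).add
      (continuous_const.inner (c4.comp continuous_snd))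
  have hc' : ∀ b : WithLp 2 (H × U) × WithLp 2 (H × Y), Continuous fun a => balance a b := fun b =>
    ((((c3.comp continuous_snd).inner continuous_const).add
      ((c1.comp continuous_fst).inner continuous_const)).sub
      ((c2.comp continuous_fst).inner continuous_const)).add
      ((c4.comp continuous_snd).inner continuous_const)
  have h1 : ∀ a ∈ s, balance a q = 0 := fun a ha =>
    closure_minimal (t := {b | balance a b = 0}) (fun b hb => hs a ha b hb)
      (isClosed_eq (hc a) continuous_const) hq
  exact closure_minimal (t := {a | balance a q = 0}) (fun a ha => h1 a ha)
    (isClosed_eq (hc' q) continuous_const) hp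

theorem balance_preGraph {φ : SchurFunction U Y}
    {p q : WithLp 2 (Hc φ × U) × WithLp 2 (Hc φ × Y)} (hp : p ∈ preGraph φ) (hq : q ∈ preGraph φ) :
    balance p q = 0 := by
  induction hp using Submodule.span_induction with
  | mem p hp =>
    obtain ⟨μ, v, rfl⟩ := hp
    induction hq using Submodule.span_induction with
    | mem q hq =>
      obtain ⟨lam, u, rfl⟩ := hq
      have hne : conj (μ : ℂ) + (lam : ℂ) ≠ 0 := by
        intro h
        have := congrArg Complex.re h
        have h1 := μ.2
        have h2 := lam.2
        simp at this
        linarith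
      simp only [balance, WithLp.toLp_fst, WithLp.toLp_snd, inner_smul_left, inner_smul_right,
        kerFun_inner_kerFun]
      field_simp
      ring
    | zero => simp [balance]
    | add a b _ _ ha hb =>
      simp only [balance, Prod.fst_add, Prod.snd_add, WithLp.add_fst, WithLp.add_snd,
        inner_add_right] at ha hb ⊢
      linear_combination ha + hb
    | smul c a _ ha =>
      simp only [balance, Prod.smul_fst, Prod.smul_snd, WithLp.smul_fst, WithLp.smul_snd,
        inner_smul_right] at ha ⊢
      linear_combination c * ha
  | zero => simp [balance]
  | add a b _ _ ha hb =>
    simp only [balance, Prod.fst_add, Prod.snd_add, WithLp.add_fst, WithLp.add_snd,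
      inner_add_left] at ha hb ⊢
    linear_combination ha + hb
  | smul c a _ ha =>
    simp only [balance, Prod.smul_fst, Prod.smul_snd, WithLp.smul_fst, WithLp.smul_snd,
      inner_smul_left] at ha ⊢
    linear_combination conj c * ha

theorem balance_closure {φ : SchurFunction U Y}
    {p q : WithLp 2 (Hc φ × U) × WithLp 2 (Hc φ × Y)} (hp : p ∈ (preGraph φ).topologicalClosure)
    (hq : q ∈ (preGraph φ).topologicalClosure) :
    balance p q = 0 :=
  balance_eq_zero_of_mem_closure
    (s := (preGraph φ : Set (WithLp 2 (Hc φ × U) × WithLp 2 (Hc φ × Y))))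
    (fun _ ha _ hb => balance_preGraph ha hb) hp hq

theorem closure_preGraph_single {φ : SchurFunction U Y}
    {p : WithLp 2 (Hc φ × U) × WithLp 2 (Hc φ × Y)} (hp : p ∈ (preGraph φ).topologicalClosure)
    (h0 : p.1 = 0) : p.2 = 0 := by
  have h1 := balance_closure hp hp
  simp only [balance, h0, WithLp.zero_fst, WithLp.zero_snd, inner_zero_left, inner_zero_right,
    add_zero, sub_zero, zero_add, inner_self_eq_zero] at h1
  have h2 : p.2.fst = 0 := by
    refine DFunLike.ext _ _ fun μ => ext_inner_right ℂ fun u => ?_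
    have hq : (WithLp.toLp 2 (RKHS.kerFun (Hc φ) μ.conj.conj u, u),
      WithLp.toLp 2 ((μ.conj : ℂ) • RKHS.kerFun (Hc φ) μ.conj.conj u, φ.toFun μ.conj u))
        ∈ preGraph φ := Submodule.subset_span ⟨μ.conj, u, rfl⟩
    have h3 := balance_closure hp ((preGraph φ).le_topologicalClosure hq)
    have hμ : μ.conj.conj = μ := by ext; simp [Cplus.conj]
    simp only [balance, h0, h1, WithLp.zero_fst, WithLp.zero_snd, inner_zero_left,
      add_zero, sub_zero, hμ] at h3
    simpa using h3
  exact WithLp.ofLp_injective 2 (Prod.ext h2 h1)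

theorem preModel_graph (φ : SchurFunction U Y) : (preModel φ).graph = preGraph φ :=
  Submodule.toLinearPMap_graph_eq _ fun _ hp h0 =>
    closure_preGraph_single ((preGraph φ).le_topologicalClosure hp) h0

theorem preModel_isClosable (φ : SchurFunction U Y) : (preModel φ).IsClosable := by
  refine ⟨(preGraph φ).topologicalClosure.toLinearPMap, ?_⟩
  rw [preModel_graph, Submodule.toLinearPMap_graph_eq]
  exact fun _ hp h0 => closure_preGraph_single hp h0

theorem model_graph (φ : SchurFunction U Y) :
    (model φ).graph = (preGraph φ).topologicalClosure := by
  rw [model, ← (preModel_isClosable φ).graph_closure_eq_closure_graph, preModel_graph]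

theorem Hc_norm_apply_le {φ : SchurFunction U Y} (x : Hc φ) (μ : Cplus) :
    ‖x μ‖ ≤ ‖x‖ * √((μ : ℂ).re⁻¹) := by
  refine (RKHS.norm_apply_le x μ).trans ?_
  gcongr
  rw [RKHS.OfKernel.kernel_ofKernel]
  have hμ := μ.2
  have h1 : ‖φ.tilde μ ∘L φ.toFun μ.conj‖ ≤ 1 := by
    refine (ContinuousLinearMap.opNorm_comp_le _ _).trans ?_
    have h2 : ‖φ.toFun μ.conj‖ ≤ 1 := φ.contractive _ μ.conj.2
    rw [SchurFunction.tilde, LinearIsometryEquiv.norm_map]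
    nlinarith [norm_nonneg (φ.toFun μ.conj)]
  have h3 : ‖ContinuousLinearMap.id ℂ U - φ.tilde μ ∘L φ.toFun μ.conj‖ ≤ 2 := by
    refine (norm_sub_le _ _).trans ?_
    linarith [ContinuousLinearMap.norm_id_le (𝕜 := ℂ) (E := U)]
  have h4 : (μ : ℂ) + conj (μ : ℂ) = ((2 * (μ : ℂ).re : ℝ) : ℂ) := by
    rw [Complex.add_conj]
  rw [Kc, Matrix.of_apply, norm_smul, h4, norm_inv, Complex.norm_real, Real.norm_eq_abs,
    abs_of_pos (by positivity), mul_inv]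
  have : 0 < ((μ : ℂ).re)⁻¹ := inv_pos.2 hμ
  nlinarith

theorem model_dense (φ : SchurFunction U Y) :
    Dense ((model φ).domain : Set (WithLp 2 (Hc φ × U))) := by
  rw [Submodule.dense_iff_topologicalClosure_eq_top, Submodule.topologicalClosure_eq_top_iff,
    Submodule.eq_bot_iff]
  intro w hw
  have hmem : ∀ (μ : Cplus) (u : U),
      WithLp.toLp 2 (RKHS.kerFun (Hc φ) μ.conj u, u) ∈ (model φ).domain := by
    intro μ u
    have : (WithLp.toLp 2 (RKHS.kerFun (Hc φ) μ.conj u, u),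
      WithLp.toLp 2 ((μ : ℂ) • RKHS.kerFun (Hc φ) μ.conj u, φ.toFun μ u)) ∈ (model φ).graph := by
      rw [model_graph]
      exact (preGraph φ).le_topologicalClosure (Submodule.subset_span ⟨μ, u, rfl⟩)
    exact LinearPMap.mem_domain_of_mem_graph this
  have h1 : ∀ μ : Cplus, w.fst μ = -w.snd := by
    intro μ
    have hμ : μ.conj.conj = μ := by ext; simp [Cplus.conj]
    refine ext_inner_left ℂ fun u => ?_
    have := (Submodule.mem_orthogonal _ _).1 hw _ (hmem μ.conj u)
    rw [WithLp.prod_inner_apply] at this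
    simp only [hμ, RKHS.kerFun_inner] at this
    rw [inner_neg_right]
    exact eq_neg_of_add_eq_zero_left this
  have h2 : w.snd = 0 := by
    have hT : Tendsto (fun t : ℝ => ‖w.fst‖ * √(t⁻¹)) atTop (𝓝 0) := by
      have := (Real.continuous_sqrt.tendsto 0).comp tendsto_inv_atTop_zero
      simpa using this.const_mul ‖w.fst‖
    have : ‖w.snd‖ ≤ 0 := by
      refine ge_of_tendsto hT ?_
      filter_upwards [eventually_gt_atTop 0] with t ht
      have := Hc_norm_apply_le w.fst (⟨(t : ℂ), by simpa using ht⟩ : Cplus)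
      rw [h1, norm_neg] at this
      simpa using this
    exact norm_le_zero_iff.1 this
  have h3 : w.fst = 0 := DFunLike.ext _ _ fun μ => by rw [h1, h2]; simp
  exact WithLp.ofLp_injective 2 (Prod.ext h3 h2)

end Model

end HalfPlane

open HalfPlane

/-!
The graph of `S_c` is the closed span of its generators, so a pair lies in the graph of `S_c*` as
soon as the adjoint relation holds against each generator. By the reproducing property, the relation
against the generator at `(μ̄, v)` is the inner product with `v` of the identity
`μ x(μ) + φ̃(μ) y = z(μ) + u`. Since `‖K_c(μ, μ)‖ ≤ 1 / Re μ`, elements of `H_c` decay like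
`(Re μ)^(-1/2)`; this identifies `u` as a limit, and hence makes it unique.
-/

namespace HalfPlane

section Adjoint

variable {𝕜 E F : Type*} [RCLike 𝕜] [NormedAddCommGroup E] [InnerProductSpace 𝕜 E]
  [NormedAddCommGroup F] [InnerProductSpace 𝕜 F]

theorem inner_eq_of_mem_topologicalClosure_span {s : Set (E × F)} {v : E} {w : F}
    (h : ∀ p ∈ s, ⟪p.2, w⟫_𝕜 = ⟪p.1, v⟫_𝕜) {p : E × F}
    (hp : p ∈ (Submodule.span 𝕜 s).topologicalClosure) : ⟪p.2, w⟫_𝕜 = ⟪p.1, v⟫_𝕜 := by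
  let T : E × F →L⋆[𝕜] 𝕜 :=
    (innerSLFlip 𝕜 w).comp (ContinuousLinearMap.snd 𝕜 E F) -
      (innerSLFlip 𝕜 v).comp (ContinuousLinearMap.fst 𝕜 E F)
  have hs : Submodule.span 𝕜 s ≤ T.ker :=
    Submodule.span_le.2 fun q hq => sub_eq_zero.2 (h q hq)
  exact sub_eq_zero.1 (Submodule.topologicalClosure_minimal _ hs T.isClosed_ker hp)

theorem mem_adjoint_topologicalClosure_span_iff {s : Set (E × F)} {q : F × E} :
    q ∈ (Submodule.span 𝕜 s).topologicalClosure.adjoint ↔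
      ∀ p ∈ s, ⟪p.2, q.1⟫_𝕜 = ⟪p.1, q.2⟫_𝕜 := by
  simp only [Submodule.mem_adjoint_iff, sub_eq_zero]
  constructor
  · intro h p hp
    exact h p.1 p.2 (Submodule.le_topologicalClosure _ (Submodule.subset_span hp))
  · intro h a b hab
    exact inner_eq_of_mem_topologicalClosure_span h hab

end Adjoint

theorem toLp_kerFun_inner {𝕜 H X V : Type*} [RCLike 𝕜] [NormedAddCommGroup V]
    [InnerProductSpace 𝕜 V] [CompleteSpace V] [NormedAddCommGroup H] [InnerProductSpace 𝕜 H]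
    [CompleteSpace H] [RKHS 𝕜 H X V] (x : X) (v : V) (z : H) (u : V) :
    ⟪WithLp.toLp 2 (RKHS.kerFun H x v, v), WithLp.toLp 2 (z, u)⟫_𝕜 = ⟪v, z x + u⟫_𝕜 := by
  simp only [WithLp.prod_inner_apply, RKHS.kerFun_inner, inner_add_right]

theorem Cplus.conj_involutive : Function.Involutive Cplus.conj := fun μ =>
  Subtype.ext (Complex.conj_conj (μ : ℂ))

instance neBot_comap_re_atTop : (comap (fun η : Cplus => (η : ℂ).re) atTop).NeBot :=
  atTop_neBot.comap_of_range_mem <|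
    mem_of_superset (Ioi_mem_atTop 0) fun t ht => ⟨⟨(t : ℂ), ht⟩, Complex.ofReal_re t⟩

section DualModel

variable {U Y : Type*} [NormedAddCommGroup U] [InnerProductSpace ℂ U] [CompleteSpace U]
  [NormedAddCommGroup Y] [InnerProductSpace ℂ Y] [CompleteSpace Y] {φ : SchurFunction U Y}

theorem toLp_smul_kerFun_inner (μ : Cplus) (v : U) (x : Hc φ) (y : Y) :
    ⟪WithLp.toLp 2 ((μ.conj : ℂ) • RKHS.kerFun (Hc φ) μ v, φ.toFun μ.conj v),
        WithLp.toLp 2 (x, y)⟫_ℂ =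
      ⟪v, (μ : ℂ) • x μ + φ.tilde μ y⟫_ℂ := by
  simp only [WithLp.prod_inner_apply, inner_smul_left, RKHS.kerFun_inner, inner_add_right,
    inner_smul_right, SchurFunction.tilde, ContinuousLinearMap.adjoint_inner_right, Cplus.conj,
    Complex.conj_conj]

theorem mem_graph_adjoint_model_iff_forall_inner
    {q : WithLp 2 (Hc φ × Y) × WithLp 2 (Hc φ × U)} :
    q ∈ (model φ).adjoint.graph ↔ ∀ (μ : Cplus) (v : U),
      ⟪WithLp.toLp 2 ((μ.conj : ℂ) • RKHS.kerFun (Hc φ) μ v, φ.toFun μ.conj v), q.1⟫_ℂ =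
        ⟪WithLp.toLp 2 (RKHS.kerFun (Hc φ) μ v, v), q.2⟫_ℂ := by
  rw [LinearPMap.adjoint_graph_eq_graph_adjoint (model_dense φ), model_graph, preGraph,
    mem_adjoint_topologicalClosure_span_iff]
  constructor
  · intro h μ v
    simpa only [Cplus.conj_involutive μ] using h _ ⟨μ.conj, v, rfl⟩
  · rintro h _ ⟨lam, v, rfl⟩
    simpa only [Cplus.conj_involutive lam] using h lam.conj v

theorem mem_graph_adjoint_model_iff {x z : Hc φ} {y : Y} {u : U} :
    (WithLp.toLp 2 (x, y), WithLp.toLp 2 (z, u)) ∈ (model φ).adjoint.graph ↔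
      ∀ μ : Cplus, z μ = (μ : ℂ) • x μ + φ.tilde μ y - u := by
  rw [mem_graph_adjoint_model_iff_forall_inner]
  refine forall_congr' fun μ => ?_
  simp only [toLp_smul_kerFun_inner, toLp_kerFun_inner]
  rw [← ext_iff_inner_left, eq_sub_iff_add_eq, eq_comm]

theorem mem_domain_adjoint_model_iff {x : Hc φ} {y : Y} :
    WithLp.toLp 2 (x, y) ∈ (model φ).adjoint.domain ↔
      ∃ (u : U) (z : Hc φ), ∀ μ : Cplus, z μ = (μ : ℂ) • x μ + φ.tilde μ y - u := by
  constructor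
  · intro h
    exact ⟨_, _, mem_graph_adjoint_model_iff.1 ((model φ).adjoint.mem_graph ⟨_, h⟩)⟩
  · rintro ⟨u, z, hz⟩
    exact LinearPMap.mem_domain_of_mem_graph (mem_graph_adjoint_model_iff.2 hz)

theorem tendsto_Hc_apply_zero (z : Hc φ) :
    Tendsto (fun η : Cplus => z η) (comap (fun η : Cplus => (η : ℂ).re) atTop) (𝓝 0) := by
  have hbound : Tendsto (fun t : ℝ => ‖z‖ * √(t⁻¹)) atTop (𝓝 0) := by
    simpa using tendsto_inv_atTop_zero.sqrt.const_mul ‖z‖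
  exact squeeze_zero_norm (Hc_norm_apply_le z) (hbound.comp tendsto_comap)

theorem tendsto_of_Hc_apply_eq_sub {f : Cplus → U} {z : Hc φ} {u : U}
    (h : ∀ μ : Cplus, z μ = f μ - u) :
    Tendsto f (comap (fun η : Cplus => (η : ℂ).re) atTop) (𝓝 u) := by
  rw [← tendsto_sub_nhds_zero_iff]
  simpa only [h] using tendsto_Hc_apply_zero z

end DualModel

end HalfPlane

theorem theorem4p4 {U Y : Type*}
    [NormedAddCommGroup U] [InnerProductSpace ℂ U] [CompleteSpace U]
    [NormedAddCommGroup Y] [InnerProductSpace ℂ Y] [CompleteSpace Y]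
    (φ : SchurFunction U Y) :
    (∀ (x : Hc φ) (y : Y), WithLp.toLp 2 (x, y) ∈ (model φ).adjoint.domain ↔
      ∃ (u : U) (z : Hc φ), ∀ μ : Cplus, z μ = (μ : ℂ) • x μ + φ.tilde μ y - u) ∧
    ∀ (x : Hc φ) (y : Y) (h : WithLp.toLp 2 (x, y) ∈ (model φ).adjoint.domain),
      ∃ (z : Hc φ) (u : U),
        (model φ).adjoint ⟨WithLp.toLp 2 (x, y), h⟩ = WithLp.toLp 2 (z, u) ∧
        (∀ μ : Cplus, z μ = (μ : ℂ) • x μ + φ.tilde μ y - u) ∧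
        Tendsto (fun η : Cplus => (η : ℂ) • x η + φ.tilde η y)
          (comap (fun η : Cplus => (η : ℂ).re) atTop) (𝓝 u) ∧
        ∀ u' : U,
          (∃ z' : Hc φ, ∀ μ : Cplus, z' μ = (μ : ℂ) • x μ + φ.tilde μ y - u') → u' = u := by
  refine ⟨fun x y => mem_domain_adjoint_model_iff, fun x y h => ?_⟩
  have hz := mem_graph_adjoint_model_iff.1 ((model φ).adjoint.mem_graph ⟨WithLp.toLp 2 (x, y), h⟩)
  have hlim := tendsto_of_Hc_apply_eq_sub hz
  refine ⟨_, _, rfl, hz, hlim, ?_⟩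
  rintro u' ⟨z', hz'⟩
  exact tendsto_nhds_unique (tendsto_of_Hc_apply_eq_sub hz') hlim
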